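/- Let $\mathbb K$ be a field and let $G=(V,E)$ be a finite digraph without loops (arrows in both directions between two vertices are allowed). Let $\Lambda_p$ be the $\mathbb K$-vector space with basis the elementary $p$-paths $e_{i_0\dots i_p}$, $i_0,\dots,i_p\in V$; let $\mathcal I_p\subseteq\Lambda_p$ be the span of those with $i_k=i_{k+1}$ for some $k$, and let $\mathcal R_p=\Lambda_p/\mathcal I_p$, with the boundary operator $\partial:\mathcal R_p\to\mathcal R_{p-1}$ induced by $\partial e_{i_0\dots i_p}=\sum_{q=0}^p(-1)^q e_{i_0\dots\widehat{i_q}\dots i_p}$. Let $\mathcal A_p$ be the span of the $e_{i_0\dots i_p}$ with $i_k\to i_{k+1}$ for all $k$, and put $\Omega_3(G)=\{u\in\mathcal A_3:\partial u\in\mathcal A_2\}$, where $\partial u$ is taken in $\mathcal R_2\supseteq\mathcal A_2$. For $a,b\in V$ let $\Omega_3^{(a,b)}(G)$ be the subspace of those $u\in\Omega_3(G)$ all of whose terms with non-zero coefficient start at $a$ and end at $b$. For $v\in V$ let $N^+(v)=\{w: v\to w\}$ and $N^-(v)=\{w:w\to v\}$; for $X,Y\subseteq V$ let $E(X,Y)$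 be the set of arrows of $G$ from $X$ to $Y$; for disjoint $X,Y$ let $\operatorname{Ind}(X,Y)$ be the digraph with vertex set $X\cup Y$ and arrow set $E(X,Y)$. For $a,b\in V$ put $A=N^+(a)\setminus\{b\}$, $B=N^-(b)\setminus\{a\}$ and $H(a,b)=\operatorname{Ind}(A\setminus B,\,B\setminus A)$. Let $t(a,b)$ be the number of connected components $H_1,\dots,H_{t(a,b)}$ of $H(a,b)$, directions being ignored and isolated vertices being counted. For $1\le k\le t(a,b)$ let $S_k(a,b)$ be the set of arrows of $G$ that either start in $V(H_k)\setminus B$ and end in $(N^+(a)\cup\{a\})\cap N^-(b)$, or start in $N^+(a)\cap(N^-(b)\cup\{b\})$ and end in $V(H_k)\setminus A$. Then $$\dim\Omega_3(G)=\sum_{a,b\in V}\dim\Omega_3^{(a,b)}(G),$$ and, more precisely, $$\begin{aligned}\dim\Omega_3(G)={}&\sum_{a,b\in V}\bigl(|E(H(a,b))|-|V(H(a,b))|+t(a,b)\bigr)\\&+\sum_{a,b\in V}\bigl|E\bigl(N^+(a)\cap(N^-(b)\cup\{b\}),\,(N^+(a)\cup\{a\})\cap N^-(b)\bigr)\bigr|\\&+\sum_{a,b\in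 V}\sum_{k=1}^{t(a,b)}\max\{0,|S_k(a,b)|-1\}.\end{aligned}$$ -/

import Mathlib

namespace GLMY

/-! ### Paths and the boundary operator -/

section Paths

variable (K : Type*) (V : Type*) [Field K]

/-- `Λ_p`: formal `K`-linear combinations of elementary `p`-paths `i₀ … i_p` in `V`. -/
abbrev Path (p : ℕ) : Type _ := (Fin (p + 1) → V) →₀ K

variable {V}

/-- The elementary path `e_{i₀ … i_p}` as an element of `Λ_p`. -/
noncomputable abbrev elem {p : ℕ} (c : Fin (p + 1) → V) : Path K V p := Finsupp.single c 1

/-- An elementary path is regular if consecutive vertices are distinct. -/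
def IsRegular {p : ℕ} (c : Fin (p + 1) → V) : Prop :=
  ∀ k : Fin p, c k.castSucc ≠ c k.succ

variable (V)

/-- The boundary operator `∂ : Λ_{p+1} → Λ_p`,
`∂ e_{i₀ … i_{p+1}} = ∑_q (-1)^q e_{i₀ … î_q … i_{p+1}}`. -/
noncomputable def boundary (p : ℕ) : Path K V (p + 1) →ₗ[K] Path K V p :=
  Finsupp.linearCombination K fun c : Fin (p + 2) → V =>
    ∑ q : Fin (p + 2), (-1 : K) ^ (q : ℕ) • elem K (fun j => c (q.succAbove j))

/-- `I_p`: the span of the irregular elementary `p`-paths. -/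
noncomputable def irregular (p : ℕ) : Submodule K (Path K V p) :=
  Submodule.span K {u | ∃ c : Fin (p + 1) → V, ¬ IsRegular c ∧ u = elem K c}

/-- `∂ I_{p+1} ⊆ I_p`. -/
theorem irregular_le_comap_boundary (p : ℕ) :
    irregular K V (p + 1) ≤ (irregular K V p).comap (boundary K V p) := by
  rw [irregular, Submodule.span_le]
  rintro _ ⟨c, hc, rfl⟩
  simp only [IsRegular, not_forall, not_not] at hc
  obtain ⟨k, hk⟩ := hc
  simp only [SetLike.mem_coe, Submodule.mem_comap, boundary, elem,
    Finsupp.linearCombination_single, one_smul]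
  have hne : k.castSucc ≠ k.succ := Fin.castSucc_lt_succ.ne
  rw [← Finset.add_sum_erase _ _ (Finset.mem_univ k.castSucc),
    ← Finset.add_sum_erase _ _ (Finset.mem_erase.2 ⟨hne.symm, Finset.mem_univ k.succ⟩),
    ← add_assoc]
  refine Submodule.add_mem _ ?_ (Submodule.sum_mem _ fun q hq => ?_)
  · have h : (fun j => c (k.castSucc.succAbove j)) = fun j => c (k.succ.succAbove j) := by
      funext j
      rcases lt_trichotomy j k with h | rfl | h
      · rw [Fin.succAbove_of_castSucc_lt _ _ (by simpa using h),
          Fin.succAbove_of_castSucc_lt _ _ (by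
            rw [Fin.lt_def] at h ⊢; simp only [Fin.val_castSucc, Fin.val_succ]; omega)]
      · simp [hk]
      · rw [Fin.succAbove_of_le_castSucc _ _ (by simpa using h.le),
          Fin.succAbove_of_le_castSucc _ _ (by
            rw [Fin.lt_def] at h; rw [Fin.le_def]
            simp only [Fin.val_castSucc, Fin.val_succ]; omega)]
    rw [h, ← add_smul]
    simp [pow_succ]
  · refine Submodule.smul_mem _ _ (Submodule.subset_span ⟨_, ?_, rfl⟩)
    simp only [Finset.mem_erase, Finset.mem_univ, and_true, ne_eq, Fin.ext_iff, Fin.val_succ,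
      Fin.val_castSucc] at hq
    have hkp := k.2
    have hqp := q.2
    intro hr
    rcases lt_or_gt_of_ne hq.2 with hlt | hgt
    · refine hr ⟨k - 1, by omega⟩ ?_
      convert hk using 2 <;>
      · rw [Fin.succAbove_of_le_castSucc _ _ (by
          rw [Fin.le_def]; simp only [Fin.val_castSucc, Fin.val_succ]; omega)]
        ext
        simp only [Fin.val_castSucc, Fin.val_succ]
        omega
    · refine hr ⟨k, by omega⟩ ?_
      convert hk using 2 <;>
      · rw [Fin.succAbove_of_castSucc_lt _ _ (by
          rw [Fin.lt_def]; simp only [Fin.val_castSucc, Fin.val_succ]; omega)]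
        ext
        simp

/-- `R_p = Λ_p / I_p`. -/
abbrev RegPath (p : ℕ) : Type _ := Path K V p ⧸ irregular K V p

/-- The boundary operator `∂ : R_{p+1} → R_p` induced on the quotients. -/
noncomputable def regBoundary (p : ℕ) : RegPath K V (p + 1) →ₗ[K] RegPath K V p :=
  Submodule.mapQ _ _ (boundary K V p) (irregular_le_comap_boundary K V p)

end Paths

/-! ### Allowed and `∂`-invariant paths -/

section Omega

variable (K : Type*) {V : Type*} [Field K] (G : Digraph V)

/-- An elementary path is allowed if consecutive vertices are joined by arrows. -/
def IsAllowed {p : ℕ} (c : Fin (p + 1) → V) : Prop :=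
  ∀ k : Fin p, G.Adj (c k.castSucc) (c k.succ)

/-- `A_p(G)`: the span of the allowed elementary `p`-paths. -/
noncomputable def allowed (p : ℕ) : Submodule K (Path K V p) :=
  Submodule.span K {u | ∃ c : Fin (p + 1) → V, IsAllowed G c ∧ u = elem K c}

/-- `Ω_p(G) = {u ∈ A_p : ∂u ∈ A_{p-1}}`, where `∂u` is taken in `R_{p-1}`, of which `A_{p-1}` is
regarded as a subspace; for `p = 0` the condition on `∂u = 0` is void. -/
noncomputable def Omega : (p : ℕ) → Submodule K (Path K V p)
  | 0 => allowed K G 0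
  | p + 1 => allowed K G (p + 1) ⊓
      ((allowed K G p).map (irregular K V p).mkQ).comap
        (regBoundary K V p ∘ₗ (irregular K V (p + 1)).mkQ)

/-- The `(a, b)`-clusters: the paths all of whose elementary terms start at `a` and end at `b`. -/
noncomputable def clusters (p : ℕ) (a b : V) : Submodule K (Path K V p) :=
  Finsupp.supported K K {c | c 0 = a ∧ c (Fin.last p) = b}

/-- `Ω_p^{(a,b)}(G)`: the space of all `∂`-invariant `(a, b)`-clusters. -/
noncomputable def OmegaCluster (p : ℕ) (a b : V) : Submodule K (Path K V p) :=
  Omega K G p ⊓ clusters K p a b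

end Omega

/-! ### Neighbourhoods, edges and induced bipartite digraphs -/

section Graph

variable {V : Type*} (G : Digraph V)

/-- The out-neighbourhood `N⁺(v)`. -/
def outN (v : V) : Set V := {w | G.Adj v w}

/-- The in-neighbourhood `N⁻(v)`. -/
def inN (v : V) : Set V := {w | G.Adj w v}

/-- `E(X, Y)`: the arrows of `G` from `X` to `Y`. -/
def edgesBetween (X Y : Set V) : Set (V × V) :=
  {e | G.Adj e.1 e.2 ∧ e.1 ∈ X ∧ e.2 ∈ Y}

/-- `Ind(X, Y)` (for disjoint `X`, `Y`): the digraph with vertex set `X ∪ Y` whose arrows are the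
arrows of `G` from `X` to `Y`. -/
def Ind (X Y : Set V) : Digraph ↥(X ∪ Y) where
  Adj u v := (u : V) ∈ X ∧ (v : V) ∈ Y ∧ G.Adj u v

/-- The arrow set of a digraph. -/
def edgeSet {W : Type*} (D : Digraph W) : Set (W × W) := {e | D.Adj e.1 e.2}

/-- The connected components of a digraph, directions being ignored. -/
abbrev Components {W : Type*} (D : Digraph W) : Type _ :=
  D.toSimpleGraphInclusive.ConnectedComponent

/-- `A = N⁺(a) \ {b}`. -/
def setA (a b : V) : Set V := outN G a \ {b}

/-- `B = N⁻(b) \ {a}`. -/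
def setB (a b : V) : Set V := inN G b \ {a}

/-- The vertex set of `H(a, b)`. -/
abbrev VH (a b : V) : Type _ := ↥((setA G a b \ setB G a b) ∪ (setB G a b \ setA G a b))

/-- `H(a, b) = Ind(A \ B, B \ A)`. -/
def H (a b : V) : Digraph (VH G a b) :=
  Ind G (setA G a b \ setB G a b) (setB G a b \ setA G a b)

/-- The vertex set `V(H_k)` of a component, as a set of vertices of `G`. -/
def compVerts (a b : V) (k : Components (H G a b)) : Set V := Subtype.val '' k.supp

/-- `S_k(a, b)`: the arrows of `G` that start in `V(H_k) \ B` and end in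
`(N⁺(a) ∪ {a}) ∩ N⁻(b)`, or start in `N⁺(a) ∩ (N⁻(b) ∪ {b})` and end in `V(H_k) \ A`. -/
def S (a b : V) (k : Components (H G a b)) : Set (V × V) :=
  edgesBetween G (compVerts G a b k \ setB G a b) ((outN G a ∪ {a}) ∩ inN G b) ∪
    edgesBetween G (outN G a ∩ (inN G b ∪ {b})) (compVerts G a b k \ setA G a b)

end Graph

end GLMY

/-!
In `∂e_{aijb} = e_{ijb} - e_{ajb} + e_{aib} - e_{aij}` the outer two faces of an allowed `3`-path
are allowed. In the regular quotient `e_{ajb}` is neither zero nor allowed exactly if `j ≠ a` and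
`a` has no arrow to `j`, and `e_{aib}` exactly if `i ≠ b` and `i` has no arrow to `b`. Hence a
combination `u` of allowed `3`-paths lies in `Ω₃` if and only if `∑ i, u_{aijb} = 0` for all
`a, b` and all `j ∈ B \ A`, and `∑ j, u_{aijb} = 0` for all `a, b` and all `i ∈ A \ B`
(`mem_Omega_three`). These equations keep `a` and `b` fixed, so `Ω₃` is the direct sum of the
spaces of clusters (`omegaThreeEquiv`).

For fixed `a, b` the unknowns are indexed by the *middle arrows* `i → j` with `a → i` and `j → b`,
and the equations by the vertices of `H(a, b)`; up to signs, the matrix of the system is the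
incidence matrix of vertices against middle arrows (`omegaClusterEquiv`). A middle arrow has two
ends in `H(a, b)`, none, or exactly one; these are the arrows of `H(a, b)`, those counted by the
second sum of the theorem, and those of the sets `S_k` (`card_middleArrows`).

The rank is found from the transposed matrix. Its kernel consists of the functions on the vertices
that are constant on every component and vanish on the components with `S_k ≠ ∅`
(`finrank_ker_transpose_incidence`), so the rank is `|V(H(a, b))| - #{k | S_k = ∅}`. Since
`|S_k| + [S_k = ∅] = 1 + max 0 (|S_k| - 1)`, the number of middle arrows minus the rank is the summand of
the theorem at `(a, b)` (`finrank_OmegaCluster_three`).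
-/

namespace GLMY

/-! ### Coordinates on the spaces of paths -/

section Coordinates

variable {K : Type*} {V : Type*} [Field K]

/-- The coefficient of `e_d` in `∂u` collects the coefficients of all the elementary paths from
which `d` arises by dropping one vertex. -/
theorem boundary_apply [Fintype V] {p : ℕ} (u : Path K V (p + 1)) (d : Fin (p + 1) → V) :
    boundary K V p u d =
      ∑ q : Fin (p + 2), (-1 : K) ^ (q : ℕ) *
        ∑ x : V, u (Fin.insertNth (α := fun _ => V) q x d) := by
  classical
  induction u using Finsupp.induction_linear with
  | zero => simp
  | add u v hu hv =>
    simp only [map_add, Finsupp.add_apply, hu, hv, Finset.sum_add_distrib, mul_add]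
  | single c r =>
    simp only [boundary, Finsupp.linearCombination_single, Finsupp.smul_apply,
      Finsupp.finsetSum_apply, smul_eq_mul, Finset.mul_sum]
    refine Finset.sum_congr rfl fun q _ => ?_
    simp only [Finsupp.single_apply, Fin.eq_insertNth_iff, ite_and, mul_ite, mul_zero, mul_one,
      Finset.sum_ite_eq, Finset.mem_univ, if_true]
    by_cases h : (fun j => c (q.succAbove j)) = d
    · rw [if_pos h, if_pos (show q.removeNth c = d from h), mul_comm]
    · rw [if_neg h, if_neg (show ¬ q.removeNth c = d from h)]

theorem allowed_eq_supported (G : Digraph V) (p : ℕ) :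
    allowed K G p = Finsupp.supported K K {c | IsAllowed G c} := by
  rw [Finsupp.supported_eq_span_single, allowed]
  congr 1
  ext u
  simp [eq_comm]

theorem irregular_eq_supported (p : ℕ) :
    irregular K V p = Finsupp.supported K K {c | ¬ IsRegular c} := by
  rw [Finsupp.supported_eq_span_single, irregular]
  congr 1
  ext u
  simp [eq_comm]

theorem mem_Omega_succ {G : Digraph V} {p : ℕ} {u : Path K V (p + 1)} :
    u ∈ Omega K G (p + 1) ↔ (∀ c, ¬ IsAllowed G c → u c = 0) ∧
      ∀ d, IsRegular d → ¬ IsAllowed G d → boundary K V p u d = 0 := by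
  have h : u ∈ Omega K G (p + 1) ↔
      u ∈ allowed K G (p + 1) ∧ boundary K V p u ∈ irregular K V p ⊔ allowed K G p := by
    rw [← Submodule.comap_map_mkQ]
    rfl
  rw [h, allowed_eq_supported, allowed_eq_supported, irregular_eq_supported,
    ← Finsupp.supported_union, Finsupp.mem_supported', Finsupp.mem_supported']
  simp only [Set.mem_union, Set.mem_ofPred_eq, not_or, not_not, and_imp]

end Coordinates

/-! ### The linear system that cuts out the invariant `3`-paths -/

section Three

variable {K : Type*} {V : Type*} [Field K] {G : Digraph V}

theorem isAllowed_three {i j k l : V} :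
    IsAllowed G ![i, j, k, l] ↔ G.Adj i j ∧ G.Adj j k ∧ G.Adj k l := by
  simp [IsAllowed, Fin.forall_fin_succ]

/-- For a `3`-path `u` with allowed terms, only the faces of `e_{aijb}` without `i` or without `j`
can fail to be allowed. They have coefficients `- ∑ i, u_{aijb}` and `∑ j, u_{aijb}` in `∂u`, and
no elementary `2`-path that is not allowed occurs as a face of both kinds. -/
theorem mem_Omega_three [Fintype V] (hG : ∀ v, ¬ G.Adj v v) {u : Path K V 3} :
    u ∈ Omega K G 3 ↔
      (∀ a i j b, ¬ (G.Adj a i ∧ G.Adj i j ∧ G.Adj j b) → u ![a, i, j, b] = 0) ∧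
      (∀ a i b, G.Adj a i → i ≠ b → ¬ G.Adj i b → ∑ j, u ![a, i, j, b] = 0) ∧
      (∀ a j b, G.Adj j b → j ≠ a → ¬ G.Adj a j → ∑ i, u ![a, i, j, b] = 0) := by
  have vec3 : ∀ d : Fin 3 → V, d = ![d 0, d 1, d 2] := fun d => by
    ext k; fin_cases k <;> rfl
  have vec4 : ∀ c : Fin 4 → V, c = ![c 0, c 1, c 2, c 3] := fun c => by
    ext k; fin_cases k <;> rfl
  have coeff : ∀ x y z, boundary K V 2 u ![x, y, z] = ∑ w, u ![w, x, y, z] -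
      ∑ w, u ![x, w, y, z] + ∑ w, u ![x, y, w, z] - ∑ w, u ![x, y, z, w] := by
    intro x y z
    have h0 : ∀ w, Fin.insertNth (α := fun _ => V) 0 w ![x, y, z] = ![w, x, y, z] := fun w => by
      ext k; fin_cases k <;> rfl
    have h1 : ∀ w, Fin.insertNth (α := fun _ => V) 1 w ![x, y, z] = ![x, w, y, z] := fun w => by
      ext k; fin_cases k <;> rfl
    have h2 : ∀ w, Fin.insertNth (α := fun _ => V) 2 w ![x, y, z] = ![x, y, w, z] := fun w => by
      ext k; fin_cases k <;> rfl
    have h3 : ∀ w, Fin.insertNth (α := fun _ => V) 3 w ![x, y, z] = ![x, y, z, w] := fun w => by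
      ext k; fin_cases k <;> rfl
    rw [boundary_apply]
    simp only [Fin.sum_univ_succ (n := 3), Fin.sum_univ_three, ← h0, ← h1, ← h2, ← h3]
    simp only [show (Fin.succ 0 : Fin 4) = 1 from rfl, show (Fin.succ 1 : Fin 4) = 2 from rfl,
      show (Fin.succ 2 : Fin 4) = 3 from rfl]
    norm_num [pow_succ]
    ring
  have allow : (∀ c, ¬ IsAllowed G c → u c = 0) ↔
      ∀ a i j b, ¬ (G.Adj a i ∧ G.Adj i j ∧ G.Adj j b) → u ![a, i, j, b] = 0 := by
    constructor
    · exact fun h a i j b hn => h _ (isAllowed_three.not.2 hn)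
    · intro h c hc
      rw [vec4 c] at hc ⊢
      exact h _ _ _ _ (isAllowed_three.not.1 hc)
  have cond : (∀ d, IsRegular d → ¬ IsAllowed G d → boundary K V 2 u d = 0) ↔
      ∀ x y z, x ≠ y → y ≠ z → ¬ (G.Adj x y ∧ G.Adj y z) → boundary K V 2 u ![x, y, z] = 0 := by
    constructor
    · intro h x y z hxy hyz hn
      refine h _ ?_ ?_
      · simp [IsRegular, Fin.forall_fin_succ, hxy, hyz]
      · simpa [IsAllowed, Fin.forall_fin_succ] using hn
    · intro h d hr hn
      have hr0 := hr 0
      have hr1 := hr 1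
      rw [vec3 d] at hn ⊢
      refine h _ _ _ hr0 hr1 ?_
      simpa [IsAllowed, Fin.forall_fin_succ] using hn
  rw [mem_Omega_succ, allow, cond]
  refine and_congr_right fun hu => ?_
  have outer : ∀ x y z, ¬ (G.Adj x y ∧ G.Adj y z) → boundary K V 2 u ![x, y, z] =
      ∑ w, u ![x, y, w, z] - ∑ w, u ![x, w, y, z] := by
    intro x y z hn
    rw [coeff, Finset.sum_eq_zero fun w _ => hu w x y z fun h => hn h.2,
      Finset.sum_eq_zero fun w _ => hu x y z w fun h => hn ⟨h.1, h.2.1⟩]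
    ring
  constructor
  · intro h
    refine ⟨fun a i b hai hib hn => ?_, fun a j b hjb hja hn => ?_⟩
    · have hai' : a ≠ i := fun h => hG i (h ▸ hai)
      have := h a i b hai' hib fun h => hn h.2
      rwa [outer _ _ _ fun h => hn h.2,
        Finset.sum_eq_zero (f := fun w => u ![a, w, i, b]) fun w _ => hu _ _ _ _ fun h => hn h.2.2,
        sub_zero] at this
    · have hjb' : j ≠ b := fun h => hG b (h ▸ hjb)
      have := h a j b hja.symm hjb' fun h => hn h.1
      rwa [outer _ _ _ fun h => hn h.1,
        Finset.sum_eq_zero (f := fun w => u ![a, j, w, b]) fun w _ => hu _ _ _ _ fun h => hn h.1,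
        zero_sub, neg_eq_zero] at this
  · rintro ⟨h1, h2⟩ x y z hxy hyz hn
    rw [outer _ _ _ hn]
    by_cases hx : G.Adj x y
    · rw [h1 x y z hx hyz fun h => hn ⟨hx, h⟩, Finset.sum_eq_zero, sub_zero]
      exact fun w _ => hu _ _ _ _ fun h => hn ⟨hx, h.2.2⟩
    · rw [Finset.sum_eq_zero fun w _ => hu x y w z fun h => hx h.1, zero_sub, neg_eq_zero]
      by_cases hz : G.Adj y z
      · exact h2 x y z hz hxy.symm hx
      · exact Finset.sum_eq_zero fun w _ => hu _ _ _ _ fun h => hz h.2.2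

end Three
/-! ### Splitting into clusters -/

section Clusters

variable {K : Type*} {V : Type*} [Field K] {G : Digraph V}

theorem mem_clusters {p : ℕ} {a b : V} {u : Path K V p} :
    u ∈ clusters K p a b ↔ ∀ c, ¬ (c 0 = a ∧ c (Fin.last p) = b) → u c = 0 := by
  rw [clusters, Finsupp.mem_supported']
  rfl

open Classical in
/-- `Ω₃` is the direct sum of its clusters: the linear system of `mem_Omega_three` relates only
coefficients of `3`-paths with common end points, so that the restrictions to the clusters can be
chosen independently. -/
noncomputable def omegaThreeEquiv [Fintype V] (hG : ∀ v, ¬ G.Adj v v) :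
    Omega K G 3 ≃ₗ[K] Π e : V × V, OmegaCluster K G 3 e.1 e.2 where
  toFun u e := ⟨u.1.filter fun c => c 0 = e.1 ∧ c (Fin.last 3) = e.2, by
    classical
    obtain ⟨u, hu⟩ := u
    rw [mem_Omega_three hG] at hu
    obtain ⟨h0, h1, h2⟩ := hu
    refine ⟨(mem_Omega_three hG).2 ⟨fun a i j b hn => ?_, fun a i b hai hib hn => ?_,
      fun a j b hjb hja hn => ?_⟩, mem_clusters.2 fun c hc => Finsupp.filter_apply_neg _ _ hc⟩
    · rw [Finsupp.filter_apply, h0 a i j b hn, ite_self]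
    all_goals
      simp only [Finsupp.filter_apply]
      change ∑ x, (if a = e.1 ∧ b = e.2 then _ else _) = _
      split_ifs
    · exact h1 a i b hai hib hn
    · exact Finset.sum_const_zero
    · exact h2 a j b hjb hja hn
    · exact Finset.sum_const_zero⟩
  map_add' u v := by
    ext e : 2
    exact Finsupp.filter_add
  map_smul' r u := by
    ext e : 2
    exact Finsupp.filter_smul
  invFun f := ⟨Finsupp.equivFunOnFinite.symm fun c => (f (c 0, c (Fin.last 3))).1 c, by
    rw [mem_Omega_three hG]
    have h := fun e => (mem_Omega_three hG).1 (f e).2.1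
    exact ⟨fun a i j b hn => (h (a, b)).1 a i j b hn,
      fun a i b hai hib hn => (h (a, b)).2.1 a i b hai hib hn,
      fun a j b hjb hja hn => (h (a, b)).2.2 a j b hjb hja hn⟩⟩
  left_inv u := by
    ext c
    exact Finsupp.filter_apply_pos
      (fun x : Fin 4 → V => x 0 = c 0 ∧ x (Fin.last 3) = c (Fin.last 3)) _ ⟨rfl, rfl⟩
  right_inv f := by
    classical
    refine funext fun ⟨a, b⟩ => Subtype.ext (Finsupp.ext fun c => ?_)
    by_cases hc : c 0 = a ∧ c (Fin.last 3) = b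
    · refine (Finsupp.filter_apply_pos
        (fun c : Fin 4 → V => c 0 = a ∧ c (Fin.last 3) = b) _ hc).trans ?_
      rw [← hc.1, ← hc.2]
      rfl
    · refine (Finsupp.filter_apply_neg
        (fun c : Fin 4 → V => c 0 = a ∧ c (Fin.last 3) = b) _ hc).trans ?_
      exact (mem_clusters.1 (f (a, b)).2.2 c hc).symm

theorem finrank_Omega_three [Fintype V] (hG : ∀ v, ¬ G.Adj v v) :
    Module.finrank K (Omega K G 3) =
      ∑ a : V, ∑ b : V, Module.finrank K (OmegaCluster K G 3 a b) := by
  have h : ∀ e : V × V, Module.Free K (OmegaCluster K G 3 e.1 e.2) := fun e =>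
    Module.Free.of_divisionRing K (OmegaCluster K G 3 e.1 e.2)
  rw [(omegaThreeEquiv hG).finrank_eq, Module.finrank_pi_fintype, Fintype.sum_prod_type]

end Clusters

/-! ### The incidence matrix of a pair of vertices -/

section Incidence

variable {V : Type*} {G : Digraph V} {a b : V}

/-- The middle arrows `i → j` of the allowed `3`-paths `a → i → j → b`. -/
def middleArrows (G : Digraph V) (a b : V) : Set (V × V) := edgesBetween G (outN G a) (inN G b)

open Classical in
/-- The signed incidence matrix of the middle arrows. Its rows are the vertices of `H(a, b)` only,
so that an arrow with just one end in `H(a, b)` has a single non-zero entry. An arrow `i → j` meets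
a vertex of `A \ B` only as its start and one of `B \ A` only as its end. -/
noncomputable def incidence (K : Type*) [Field K] (G : Digraph V) (a b : V) :
    Matrix (VH G a b) (middleArrows G a b) K := fun w e =>
  (if e.1.1 = w.1 ∧ w.1 ∈ setA G a b \ setB G a b then 1 else 0) -
    (if e.1.2 = w.1 ∧ w.1 ∈ setB G a b \ setA G a b then 1 else 0)

theorem mem_setA_diff_setB (hG : ∀ v, ¬ G.Adj v v) {v : V} :
    v ∈ setA G a b \ setB G a b ↔ G.Adj a v ∧ v ≠ b ∧ ¬ G.Adj v b := by
  constructor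
  · rintro ⟨⟨h1, h2⟩, h3⟩
    exact ⟨h1, h2, fun h => h3 ⟨h, fun h' => hG a (by rwa [show v = a from h'] at h1)⟩⟩
  · rintro ⟨h1, h2, h3⟩
    exact ⟨⟨h1, h2⟩, fun h => h3 h.1⟩

theorem mem_setB_diff_setA (hG : ∀ v, ¬ G.Adj v v) {v : V} :
    v ∈ setB G a b \ setA G a b ↔ G.Adj v b ∧ v ≠ a ∧ ¬ G.Adj a v := by
  constructor
  · rintro ⟨⟨h1, h2⟩, h3⟩
    exact ⟨h1, h2, fun h => h3 ⟨h, fun h' => hG b (by rwa [show v = b from h'] at h1)⟩⟩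
  · rintro ⟨h1, h2, h3⟩
    exact ⟨⟨h1, h2⟩, fun h => h3 h.1⟩

theorem sum_middleArrows {M : Type*} [AddCommMonoid M] [Fintype V]
    [Fintype (middleArrows G a b)] (f : V → V → M)
    (hf : ∀ i j, ¬ (G.Adj a i ∧ G.Adj i j ∧ G.Adj j b) → f i j = 0) :
    ∑ e : middleArrows G a b, f e.1.1 e.1.2 = ∑ i, ∑ j, f i j := by
  classical
  rw [← Fintype.sum_prod_type' f]
  refine Eq.symm ?_
  convert Finset.sum_congr_set (middleArrows G a b) (fun e : V × V => f e.1 e.2)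
    (fun e => f e.1.1 e.1.2) (fun _ _ => rfl)
    fun _ he => hf _ _ fun h => he ⟨h.2.1, h.1, h.2.2⟩

/-- The two families of equations that single out the `∂`-invariant `(a, b)`-clusters among the
allowed ones are the rows of the system with matrix `incidence K G a b`. -/
theorem incidence_mulVec_eq_zero_iff {K : Type*} [Field K] [Fintype V]
    [Fintype (middleArrows G a b)] (hG : ∀ v, ¬ G.Adj v v) (f : V → V → K)
    (hf : ∀ i j, ¬ (G.Adj a i ∧ G.Adj i j ∧ G.Adj j b) → f i j = 0) :
    (incidence K G a b).mulVec (fun e => f e.1.1 e.1.2) = 0 ↔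
      (∀ i, G.Adj a i → i ≠ b → ¬ G.Adj i b → ∑ j, f i j = 0) ∧
      (∀ j, G.Adj j b → j ≠ a → ¬ G.Adj a j → ∑ i, f i j = 0) := by
  classical
  have key : ∀ w : VH G a b, (incidence K G a b).mulVec (fun e => f e.1.1 e.1.2) w =
      (if w.1 ∈ setA G a b \ setB G a b then ∑ j, f w j else 0) -
        (if w.1 ∈ setB G a b \ setA G a b then ∑ i, f i w else 0) := by
    intro w
    refine (sum_middleArrows (fun i j =>
      ((if i = w.1 ∧ w.1 ∈ setA G a b \ setB G a b then 1 else 0) -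
      (if j = w.1 ∧ w.1 ∈ setB G a b \ setA G a b then 1 else 0)) * f i j) fun i j h => ?_).trans ?_
    · rw [hf i j h, mul_zero]
    · simp only [sub_mul, ite_mul, one_mul, zero_mul, Finset.sum_sub_distrib, ite_and,
        Finset.sum_ite_eq', Finset.mem_univ, if_true]
      congr 1
      · rw [Finset.sum_comm]
        simp only [Finset.sum_ite_eq', Finset.mem_univ, if_true, Finset.sum_ite_irrel,
          Finset.sum_const_zero]
      · split_ifs
        exacts [rfl, Finset.sum_const_zero]
  rw [funext_iff]
  constructor
  · intro h
    constructor
    · intro i h1 h2 h3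
      have hi := (mem_setA_diff_setB (G := G) hG).2 ⟨h1, h2, h3⟩
      have := h ⟨i, Or.inl hi⟩
      rwa [key, if_pos hi, if_neg fun h' => h'.2 hi.1, sub_zero] at this
    · intro i h1 h2 h3
      have hi := (mem_setB_diff_setA (G := G) hG).2 ⟨h1, h2, h3⟩
      have := h ⟨i, Or.inr hi⟩
      rwa [key, if_pos hi, if_neg fun h' => h'.2 hi.1, zero_sub, Pi.zero_apply,
        neg_eq_zero] at this
  · rintro ⟨h1, h2⟩ ⟨w, hw | hw⟩
    · obtain ⟨ha, hb, hc⟩ := (mem_setA_diff_setB hG).1 hw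
      rw [key, if_pos hw, if_neg fun h' => h'.2 hw.1, h1 w ha hb hc]
      exact sub_zero _
    · obtain ⟨ha, hb, hc⟩ := (mem_setB_diff_setA hG).1 hw
      rw [key, if_pos hw, if_neg fun h' => h'.2 hw.1, h2 w ha hb hc]
      exact sub_zero _

open Classical in
/-- The `∂`-invariant `(a, b)`-clusters are the solutions of the system with matrix
`incidence K G a b`: an allowed cluster is a function on the middle arrows, extended by zero. -/
noncomputable def omegaClusterEquiv (K : Type*) [Field K] [Fintype V]
    [Fintype (middleArrows G a b)] (hG : ∀ v, ¬ G.Adj v v) :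
    OmegaCluster K G 3 a b ≃ₗ[K] LinearMap.ker (incidence K G a b).mulVecLin where
  toFun u := ⟨fun e => u.1 ![a, e.1.1, e.1.2, b], by
    have h := (mem_Omega_three hG).1 u.2.1
    exact (incidence_mulVec_eq_zero_iff hG (fun i j => u.1 ![a, i, j, b]) (h.1 a · · b)).2
      ⟨(h.2.1 a · b), (h.2.2 a · b)⟩⟩
  map_add' u v := rfl
  map_smul' r u := rfl
  invFun f := ⟨Finsupp.equivFunOnFinite.symm fun c =>
      if h : (c 0 = a ∧ c 3 = b) ∧ (c 1, c 2) ∈ middleArrows G a b then f.1 ⟨_, h.2⟩ else 0, by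
    obtain ⟨f, hf⟩ := f
    have key : (fun e : middleArrows G a b => if h : (e.1.1, e.1.2) ∈ middleArrows G a b
        then f ⟨_, h⟩ else 0) = f := funext fun e => dif_pos e.2
    rw [← key, LinearMap.mem_ker, Matrix.mulVecLin_apply, incidence_mulVec_eq_zero_iff hG
      (fun i j => if h : (i, j) ∈ middleArrows G a b then f ⟨_, h⟩ else 0)
      fun i j h => dif_neg fun h' => h ⟨h'.2.1, h'.1, h'.2.2⟩] at hf
    refine ⟨(mem_Omega_three hG).2 ⟨fun x i j y hn => ?_, fun x i y h1 h2 h3 => ?_,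
      fun x j y h1 h2 h3 => ?_⟩, mem_clusters.2 fun c hc => dif_neg fun h => hc h.1⟩
    · refine dif_neg ?_
      rintro ⟨⟨rfl, rfl⟩, h⟩
      exact hn ⟨h.2.1, h.1, h.2.2⟩
    · by_cases hxy : x = a ∧ y = b
      · obtain ⟨rfl, rfl⟩ := hxy
        convert hf.1 i h1 h2 h3 using 2
        exact dite_congr (propext (and_iff_right ⟨rfl, rfl⟩)) (fun _ => rfl) fun _ => rfl
      · exact Finset.sum_eq_zero fun j _ => dif_neg fun h => hxy h.1
    · by_cases hxy : x = a ∧ y = b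
      · obtain ⟨rfl, rfl⟩ := hxy
        convert hf.2 j h1 h2 h3 using 2
        exact dite_congr (propext (and_iff_right ⟨rfl, rfl⟩)) (fun _ => rfl) fun _ => rfl
      · exact Finset.sum_eq_zero fun j _ => dif_neg fun h => hxy h.1⟩
  left_inv u := by
    ext c
    by_cases hc : (c 0 = a ∧ c 3 = b) ∧ (c 1, c 2) ∈ middleArrows G a b
    · refine (dif_pos hc).trans (congrArg u.1 ?_)
      ext k
      fin_cases k
      exacts [hc.1.1.symm, rfl, rfl, hc.1.2.symm]
    · refine (dif_neg hc).trans ?_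
      by_cases hc' : c 0 = a ∧ c 3 = b
      · have hcv : c = ![c 0, c 1, c 2, c 3] := by ext k; fin_cases k <;> rfl
        rw [hcv, ((mem_Omega_three hG).1 u.2.1).1 _ _ _ _ fun h => hc ⟨hc', ?_⟩]
        rw [hc'.1, hc'.2] at h
        exact ⟨h.2.1, h.1, h.2.2⟩
      · exact (mem_clusters.1 u.2.2 c hc').symm
  right_inv f := by
    ext e
    exact dif_pos ⟨⟨rfl, rfl⟩, e.2⟩

end Incidence
/-! ### Middle arrows and components -/

section Components

variable {V : Type*} {G : Digraph V} {a b : V}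

/-- The component of `H(a, b)` that contains the vertex `w`. -/
abbrev comp (G : Digraph V) (a b : V) (w : VH G a b) : Components (H G a b) :=
  (H G a b).toSimpleGraphInclusive.connectedComponentMk w

theorem comp_eq_of_adj {u v : VH G a b} (h : (H G a b).Adj u v) :
    comp G a b u = comp G a b v := by
  by_cases huv : u = v
  · rw [huv]
  · exact SimpleGraph.ConnectedComponent.sound (SimpleGraph.Adj.reachable ⟨huv, Or.inl h⟩)

theorem mem_compVerts_diff_setB {k : Components (H G a b)} {v : V} :
    v ∈ compVerts G a b k \ setB G a b ↔
      ∃ h : v ∈ setA G a b \ setB G a b, comp G a b ⟨v, Or.inl h⟩ = k := by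
  constructor
  · rintro ⟨⟨⟨w, hw | hw⟩, hk, rfl⟩, hB⟩
    exacts [⟨hw, hk⟩, (hB hw.1).elim]
  · rintro ⟨h, hk⟩
    exact ⟨⟨_, hk, rfl⟩, h.2⟩

theorem mem_compVerts_diff_setA {k : Components (H G a b)} {v : V} :
    v ∈ compVerts G a b k \ setA G a b ↔
      ∃ h : v ∈ setB G a b \ setA G a b, comp G a b ⟨v, Or.inr h⟩ = k := by
  constructor
  · rintro ⟨⟨⟨w, hw | hw⟩, hk, rfl⟩, hB⟩
    exacts [(hB hw.1).elim, ⟨hw, hk⟩]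
  · rintro ⟨h, hk⟩
    exact ⟨⟨_, hk, rfl⟩, h.2⟩

theorem mem_outN_inter_iff (hG : ∀ v, ¬ G.Adj v v) {v : V} :
    v ∈ outN G a ∩ (inN G b ∪ {b}) ↔ G.Adj a v ∧ v ∉ setA G a b \ setB G a b := by
  rw [mem_setA_diff_setB hG]
  simp only [outN, inN, Set.mem_inter_iff, Set.mem_union, Set.mem_ofPred_eq,
    Set.mem_singleton_iff]
  tauto

theorem mem_inter_inN_iff (hG : ∀ v, ¬ G.Adj v v) {v : V} :
    v ∈ (outN G a ∪ {a}) ∩ inN G b ↔ G.Adj v b ∧ v ∉ setB G a b \ setA G a b := by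
  rw [mem_setB_diff_setA hG]
  simp only [outN, inN, Set.mem_inter_iff, Set.mem_union, Set.mem_ofPred_eq,
    Set.mem_singleton_iff]
  tauto

/-- The arrows counted by the second sum are the middle arrows without an end in `H(a, b)`. -/
theorem mem_edgesBetween_iff (hG : ∀ v, ¬ G.Adj v v) {e : V × V} :
    e ∈ edgesBetween G (outN G a ∩ (inN G b ∪ {b})) ((outN G a ∪ {a}) ∩ inN G b) ↔
      e ∈ middleArrows G a b ∧ e.1 ∉ setA G a b \ setB G a b ∧
        e.2 ∉ setB G a b \ setA G a b := by
  change _ ∧ _ ∧ _ ↔ (_ ∧ G.Adj a e.1 ∧ G.Adj e.2 b) ∧ _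
  rw [mem_outN_inter_iff hG, mem_inter_inN_iff hG]
  tauto

/-- `S_k` consists of the middle arrows with exactly one end in `H(a, b)`, that end being a vertex
of `H_k`. -/
theorem mem_S_iff (hG : ∀ v, ¬ G.Adj v v) {k : Components (H G a b)} {e : V × V} :
    e ∈ S G a b k ↔ e ∈ middleArrows G a b ∧
      ((∃ h : e.1 ∈ setA G a b \ setB G a b, comp G a b ⟨e.1, Or.inl h⟩ = k) ∧
          e.2 ∉ setB G a b \ setA G a b ∨
        e.1 ∉ setA G a b \ setB G a b ∧
          ∃ h : e.2 ∈ setB G a b \ setA G a b, comp G a b ⟨e.2, Or.inr h⟩ = k) := by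
  change (_ ∧ _ ∧ _) ∨ (_ ∧ _ ∧ _) ↔ (_ ∧ G.Adj a e.1 ∧ G.Adj e.2 b) ∧ _
  rw [mem_outN_inter_iff hG, mem_inter_inN_iff hG, mem_compVerts_diff_setA,
    mem_compVerts_diff_setB]
  have h1 : (∃ h : e.1 ∈ setA G a b \ setB G a b, comp G a b ⟨e.1, Or.inl h⟩ = k) →
    G.Adj a e.1 := fun h => h.1.1.1
  have h2 : (∃ h : e.2 ∈ setB G a b \ setA G a b, comp G a b ⟨e.2, Or.inr h⟩ = k) →
    G.Adj e.2 b := fun h => h.1.1.1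
  tauto

theorem card_middleArrows [Finite V] (hG : ∀ v, ¬ G.Adj v v) :
    Nat.card (middleArrows G a b) = (edgeSet (H G a b)).ncard +
      (edgesBetween G (outN G a ∩ (inN G b ∪ {b})) ((outN G a ∪ {a}) ∩ inN G b)).ncard +
      ∑ᶠ k : Components (H G a b), (S G a b k).ncard := by
  classical
  have : Finite (Components (H G a b)) := Quot.finite _
  have := Fintype.ofFinite (Components (H G a b))
  -- A middle arrow has two ends, no end or exactly one end in `H(a, b)`.
  let F : (edgeSet (H G a b) ⊕
      edgesBetween G (outN G a ∩ (inN G b ∪ {b})) ((outN G a ∪ {a}) ∩ inN G b)) ⊕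
      (Σ k : Components (H G a b), S G a b k) → V × V :=
    Sum.elim (Sum.elim (fun e => (e.1.1.1, e.1.2.1)) Subtype.val) fun s => s.2.1
  have hF : Function.Injective F := by
    refine Function.Injective.sumElim (Function.Injective.sumElim ?_ Subtype.val_injective ?_)
      ?_ ?_
    · rintro ⟨⟨u, v⟩, h⟩ ⟨⟨u', v'⟩, h'⟩ heq
      simp only [Prod.mk.injEq] at heq
      simp only [Subtype.mk.injEq, Prod.mk.injEq]
      exact ⟨Subtype.ext heq.1, Subtype.ext heq.2⟩
    · rintro ⟨⟨u, v⟩, h⟩ ⟨e, he⟩ rfl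
      exact ((mem_edgesBetween_iff hG).1 he).2.1 h.1
    · rintro ⟨k, e, h⟩ ⟨k', e', h'⟩ (rfl : e = e')
      have : k = k' := by
        obtain ⟨-, ⟨⟨h1, rfl⟩, h2⟩ | ⟨h1, h2, rfl⟩⟩ := (mem_S_iff hG).1 h
        · obtain ⟨-, ⟨⟨h1', rfl⟩, -⟩ | ⟨h1', -⟩⟩ := (mem_S_iff hG).1 h'
          exacts [rfl, (h1' h1).elim]
        · obtain ⟨-, ⟨⟨h1', -⟩, -⟩ | ⟨-, h2', rfl⟩⟩ := (mem_S_iff hG).1 h'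
          exacts [(h1 h1').elim, rfl]
      subst this
      rfl
    · rintro (⟨⟨u, v⟩, h⟩ | ⟨e, he⟩) ⟨k, e', h'⟩ rfl
      · obtain ⟨-, ⟨-, h2⟩ | ⟨h1, -⟩⟩ := (mem_S_iff hG).1 h'
        exacts [h2 h.2.1, h1 h.1]
      · have he := (mem_edgesBetween_iff hG).1 he
        obtain ⟨-, ⟨⟨h1, -⟩, -⟩ | ⟨-, h2, -⟩⟩ := (mem_S_iff hG).1 h'
        exacts [he.2.1 h1, he.2.2 h2]
  have hrange : Set.range F = middleArrows G a b := by
    apply Set.Subset.antisymm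
    · rintro _ ⟨(⟨⟨u, v⟩, h⟩ | ⟨e, he⟩) | ⟨k, e, h⟩, rfl⟩
      · exact ⟨h.2.2, h.1.1.1, h.2.1.1.1⟩
      · exact ((mem_edgesBetween_iff hG).1 he).1
      · exact ((mem_S_iff hG).1 h).1
    · intro e he
      by_cases h1 : e.1 ∈ setA G a b \ setB G a b <;>
        by_cases h2 : e.2 ∈ setB G a b \ setA G a b
      · exact ⟨Sum.inl (Sum.inl ⟨(⟨e.1, Or.inl h1⟩, ⟨e.2, Or.inr h2⟩), h1, h2, he.1⟩), rfl⟩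
      · exact ⟨Sum.inr ⟨_, e, (mem_S_iff hG).2 ⟨he, Or.inl ⟨⟨h1, rfl⟩, h2⟩⟩⟩, rfl⟩
      · exact ⟨Sum.inr ⟨_, e, (mem_S_iff hG).2 ⟨he, Or.inr ⟨h1, h2, rfl⟩⟩⟩, rfl⟩
      · exact ⟨Sum.inl (Sum.inr ⟨e, (mem_edgesBetween_iff hG).2 ⟨he, h1, h2⟩⟩), rfl⟩
  rw [← hrange, ← Nat.card_congr (Equiv.ofInjective F hF), Nat.card_sum, Nat.card_sum,
    Nat.card_sigma, finsum_eq_sum_of_fintype]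
  rfl

end Components

/-! ### The rank of the incidence matrix -/

section Rank

variable {K : Type*} [Field K] {V : Type*} {G : Digraph V} {a b : V}

open Classical in
theorem transpose_incidence_mulVec [Fintype (VH G a b)] (g : VH G a b → K)
    (e : middleArrows G a b) :
    (incidence K G a b).transpose.mulVec g e =
      (if h : e.1.1 ∈ setA G a b \ setB G a b then g ⟨e.1.1, Or.inl h⟩ else 0) -
        (if h : e.1.2 ∈ setB G a b \ setA G a b then g ⟨e.1.2, Or.inr h⟩ else 0) := by
  have key : ∀ (v : V) (X : Set V) [Decidable (v ∈ X)]
      (hX : ∀ x ∈ X, x ∈ (setA G a b \ setB G a b) ∪ (setB G a b \ setA G a b)),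
      ∑ w : VH G a b, (if v = w.1 ∧ w.1 ∈ X then (1 : K) else 0) * g w =
        if h : v ∈ X then g ⟨v, hX v h⟩ else 0 := by
    intro v X _ hX
    split_ifs with h
    · rw [Finset.sum_eq_single ⟨v, hX v h⟩, if_pos ⟨rfl, h⟩, one_mul]
      · intro w _ hw
        rw [if_neg fun h' => hw (Subtype.ext h'.1.symm), zero_mul]
      · exact fun h' => (h' (Finset.mem_univ _)).elim
    · refine Finset.sum_eq_zero fun w _ => ?_
      rw [if_neg fun h' : v = w.1 ∧ w.1 ∈ X => h (h'.1 ▸ h'.2), zero_mul]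
  refine Eq.trans ?_ (congrArg₂ (· - ·) (key e.1.1 (setA G a b \ setB G a b) fun _ => Or.inl)
    (key e.1.2 (setB G a b \ setA G a b) fun _ => Or.inr))
  rw [← Finset.sum_sub_distrib]
  refine Finset.sum_congr rfl fun w _ => ?_
  simp only [← sub_mul, incidence, Matrix.transpose_apply]
  congr!

/-- A vector in the kernel of the transposed incidence matrix is a function on the vertices of
`H(a, b)` that takes the same value at the two ends of each arrow of `H(a, b)`, and vanishes at the
end of each arrow of `S_k`: an arbitrary function on the components with `S_k = ∅`. -/
theorem finrank_ker_transpose_incidence [Finite V] [Fintype (VH G a b)]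
    (hG : ∀ v, ¬ G.Adj v v) :
    Module.finrank K (LinearMap.ker (incidence K G a b).transpose.mulVecLin) =
      Nat.card {k : Components (H G a b) // S G a b k = ∅} := by
  classical
  have : Finite (Components (H G a b)) := Quot.finite _
  have := Fintype.ofFinite {k : Components (H G a b) // S G a b k = ∅}
  have mem_ker : ∀ g : VH G a b → K,
      g ∈ LinearMap.ker (incidence K G a b).transpose.mulVecLin ↔ ∀ e : middleArrows G a b,
        (if h : e.1.1 ∈ setA G a b \ setB G a b then g ⟨e.1.1, Or.inl h⟩ else 0) =
          (if h : e.1.2 ∈ setB G a b \ setA G a b then g ⟨e.1.2, Or.inr h⟩ else 0) := by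
    intro g
    rw [LinearMap.mem_ker, Matrix.mulVecLin_apply, funext_iff]
    simp only [transpose_incidence_mulVec, Pi.zero_apply, sub_eq_zero]
  let Φ : ({k : Components (H G a b) // S G a b k = ∅} → K) →ₗ[K] VH G a b → K :=
    { toFun := fun h w => if hk : S G a b (comp G a b w) = ∅ then h ⟨_, hk⟩ else 0
      map_add' := fun h h' => by
        ext w
        simp only [Pi.add_apply]
        split_ifs <;> simp
      map_smul' := fun r h => by
        ext w
        simp only [Pi.smul_apply, RingHom.id_apply]
        split_ifs <;> simp }
  have Φ_neg : ∀ h w, ¬ S G a b (comp G a b w) = ∅ → Φ h w = 0 := fun h w hw => dif_neg hw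
  have Φ_congr : ∀ h w w', comp G a b w = comp G a b w' → Φ h w = Φ h w' := by
    intro h w w' hw
    simp only [Φ, LinearMap.coe_mk, AddHom.coe_mk, hw]
  have inj : Function.Injective Φ := by
    intro h h' heq
    ext ⟨k, hk⟩
    induction k using SimpleGraph.ConnectedComponent.ind with
    | h w =>
      have := congrFun heq w
      simpa only [Φ, LinearMap.coe_mk, AddHom.coe_mk, dif_pos hk] using this
  have range : LinearMap.range Φ = LinearMap.ker (incidence K G a b).transpose.mulVecLin := by
    ext g
    rw [mem_ker]
    constructor
    · rintro ⟨h, rfl⟩ ⟨e, he⟩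
      by_cases h1 : e.1 ∈ setA G a b \ setB G a b <;>
        by_cases h2 : e.2 ∈ setB G a b \ setA G a b
      · rw [dif_pos h1, dif_pos h2]
        exact Φ_congr _ _ _ (comp_eq_of_adj ⟨h1, h2, he.1⟩)
      · rw [dif_pos h1, dif_neg h2]
        exact Φ_neg _ _ (Set.Nonempty.ne_empty
          ⟨e, (mem_S_iff hG).2 ⟨he, Or.inl ⟨⟨h1, rfl⟩, h2⟩⟩⟩)
      · rw [dif_neg h1, dif_pos h2]
        exact (Φ_neg _ _ (Set.Nonempty.ne_empty
          ⟨e, (mem_S_iff hG).2 ⟨he, Or.inr ⟨h1, h2, rfl⟩⟩⟩)).symm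
      · rw [dif_neg h1, dif_neg h2]
    · intro hg
      have adj : ∀ u v, (H G a b).Adj u v → g u = g v := by
        intro u v huv
        have := hg ⟨(u.1, v.1), huv.2.2, huv.1.1.1, huv.2.1.1.1⟩
        rwa [dif_pos huv.1, dif_pos huv.2.1] at this
      have const : ∀ u v, comp G a b u = comp G a b v → g u = g v := by
        intro u v huv
        obtain ⟨p⟩ := SimpleGraph.ConnectedComponent.exact huv
        clear huv
        induction p with
        | nil => rfl
        | cons h _ ih => exact (h.2.elim (adj _ _) fun h' => (adj _ _ h').symm).trans ih
      refine ⟨fun k => g (Quot.out k.1), funext fun w => ?_⟩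
      by_cases hw : S G a b (comp G a b w) = ∅
      · exact (dif_pos hw).trans (const _ _ (Quot.out_eq _))
      · rw [Φ_neg _ _ hw]
        obtain ⟨e, he⟩ := Set.nonempty_iff_ne_empty.2 hw
        obtain ⟨hm, ⟨⟨h1, hk⟩, h2⟩ | ⟨h1, h2, hk⟩⟩ := (mem_S_iff hG).1 he
        · have := hg ⟨e, hm⟩
          rw [dif_pos h1, dif_neg h2] at this
          rw [← const _ _ hk, this]
        · have := hg ⟨e, hm⟩
          rw [dif_neg h1, dif_pos h2] at this
          rw [← const _ _ hk, this]
  rw [← range, LinearMap.finrank_range_of_inj inj, Module.finrank_fintype_fun_eq_card,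
    Nat.card_eq_fintype_card]

/-- Row rank equals column rank. -/
theorem finrank_ker_mulVecLin_add {m n : Type*} [Fintype m] [Fintype n] (M : Matrix m n K) :
    Module.finrank K (LinearMap.ker M.mulVecLin) + Fintype.card m =
      Module.finrank K (LinearMap.ker M.transpose.mulVecLin) + Fintype.card n := by
  have h1 := M.mulVecLin.finrank_range_add_finrank_ker
  have h2 := M.transpose.mulVecLin.finrank_range_add_finrank_ker
  rw [Module.finrank_fintype_fun_eq_card] at h1 h2
  have h3 : Module.finrank K (LinearMap.range M.transpose.mulVecLin) =
    Module.finrank K (LinearMap.range M.mulVecLin) := M.rank_transpose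
  omega

theorem finrank_OmegaCluster_three [Fintype V] (hG : ∀ v, ¬ G.Adj v v) :
    (Module.finrank K (OmegaCluster K G 3 a b) : ℤ) =
      ((edgeSet (H G a b)).ncard - Nat.card (VH G a b) + Nat.card (Components (H G a b))) +
      (edgesBetween G (outN G a ∩ (inN G b ∪ {b})) ((outN G a ∪ {a}) ∩ inN G b)).ncard +
      ∑ᶠ k : Components (H G a b), max 0 (((S G a b k).ncard : ℤ) - 1) := by
  classical
  have : Finite (Components (H G a b)) := Quot.finite _
  have := Fintype.ofFinite (Components (H G a b))
  have h1 := finrank_ker_mulVecLin_add (incidence K G a b)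
  rw [← (omegaClusterEquiv K hG).finrank_eq, finrank_ker_transpose_incidence hG,
    ← Nat.card_eq_fintype_card, ← Nat.card_eq_fintype_card, card_middleArrows hG,
    finsum_eq_sum_of_fintype] at h1
  have h2 : ∑ k, max 0 (((S G a b k).ncard : ℤ) - 1) + Nat.card (Components (H G a b)) =
      ∑ k, ((S G a b k).ncard : ℤ) +
        Nat.card {k : Components (H G a b) // S G a b k = ∅} := by
    rw [Nat.card_eq_fintype_card, Nat.card_eq_fintype_card, Fintype.card_subtype,
      Finset.card_filter, Fintype.card_eq_sum_ones, Nat.cast_sum, Nat.cast_sum,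
      ← Finset.sum_add_distrib, ← Finset.sum_add_distrib]
    refine Finset.sum_congr rfl fun k _ => ?_
    split_ifs with hk
    · simp [hk]
    · have := (Set.ncard_pos (Set.toFinite _)).2 (Set.nonempty_iff_ne_empty.2 hk)
      rw [max_eq_right (by omega)]
      push_cast
      ring
  rw [finsum_eq_sum_of_fintype]
  zify at h1
  linarith

end Rank
end GLMY

theorem mainTheorem3 (K : Type*) [Field K] (V : Type*) [Fintype V]
    (G : Digraph V) (hG : ∀ v, ¬ G.Adj v v) :
    Module.finrank K (GLMY.Omega K G 3) =
      ∑ a : V, ∑ b : V, Module.finrank K (GLMY.OmegaCluster K G 3 a b) ∧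
    (Module.finrank K (GLMY.Omega K G 3) : ℤ) =
      ∑ a : V, ∑ b : V,
        (((GLMY.edgeSet (GLMY.H G a b)).ncard : ℤ) - (Nat.card (GLMY.VH G a b) : ℤ) +
          (Nat.card (GLMY.Components (GLMY.H G a b)) : ℤ)) +
      ∑ a : V, ∑ b : V,
        ((GLMY.edgesBetween G
          (GLMY.outN G a ∩ (GLMY.inN G b ∪ {b}))
          ((GLMY.outN G a ∪ {a}) ∩ GLMY.inN G b)).ncard : ℤ) +
      ∑ a : V, ∑ b : V, ∑ᶠ k : GLMY.Components (GLMY.H G a b),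
        max 0 (((GLMY.S G a b k).ncard : ℤ) - 1) := by
  refine ⟨GLMY.finrank_Omega_three hG, ?_⟩
  rw [GLMY.finrank_Omega_three hG]
  simp only [Nat.cast_sum, GLMY.finrank_OmegaCluster_three hG, Finset.sum_add_distrib]
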